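/- Let $\mu,\delta,q>0$, and for $n=0,1,2,\dots$ put $a_n=\dfrac{2\mu}{q\delta^2(n+1)}$. Write $(a)_k=a(a+1)\cdots(a+k-1)$ and $$f_n(x)={}_2F_1\!\left(-n,\,a_n+1;\,a_n-n;\,q e^{-\delta x}\right),$$ a terminating series, which is well defined when $(a_n-n)_n\neq 0$ (in particular when $2\mu>q\delta^2(n+1)^2$). Put $$I_{nm}=\int_{\log(q)/\delta}^{\infty} e^{-\frac{(2+m+n)\left(2\mu-q\delta^2(1+m)(1+n)\right)x}{2\delta(1+m)(1+n)q}}\left(1-qe^{-\delta x}\right)^2 f_n(x)f_m(x)\,dx .$$ (i) If $m\ne n$, $2\mu>q\delta^2(m+1)(n+1)$ and $f_n,f_m$ are well defined, then the integral converges absolutely and $I_{nm}=0$. (ii) If $2\mu>q\delta^2(n+1)^2$, then $f_n$ is well defined, the integral $I_{nn}$ converges absolutely, is positive, and $$I_{nn}=\frac{2\,q^{\,n+1-a_n}\,\Gamma(a_n-n-1)}{\delta\,\Gamma(a_n-n+2)}\left[T_n+{}_3F_2\!\left(\begin{matrix}-n,\;a_n+1,\;a_n-n-1\\ a_n-n,\;a_n-n+2\end{matrix}\,\Big|\,1\right)\right],$$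 where $T_0=0$ and, for $n\ge 1$, $$T_n=\frac{q\delta^2(n+1)\left(2\mu-q\delta^2(n+1)^2\right)(a_n+1)_n}{2\left(2\mu-q\delta^2(n+1)\right)\left(q\delta^2(n+1)+\mu\right)(-a_n-1)_n}\;{}_3F_2\!\left(\begin{matrix}1-n,\;a_n+1,\;a_n\\ a_n+3,\;a_n-n\end{matrix}\,\Big|\,1\right).$$ (iii) Consequently the eigenfunctions $$\psi_n(x)=I_{nn}^{-1/2}\left(1-qe^{-\delta x}\right)e^{-\left(\frac{\mu}{q\delta(n+1)}-\frac{(n+1)\delta}{2}\right)x}f_n(x),\qquad 2\mu>q\delta^2(n+1)^2,$$ are orthonormal on $(\log(q)/\delta,\infty)$: $\int\psi_n\psi_m\,dx=\delta_{nm}$, with absolutely convergent integrals. (iv) In particular, for $\delta=1$ and $v=2\mu>q(n+1)^2$, put $b=\dfrac{v}{q(n+1)}$. The quantity $$B_n=\frac{2\,q^{\,n+1-b}\,\Gamma(b-n-1)}{\Gamma(b-n+2)}\left[S_n+{}_3F_2\!\left(\begin{matrix}-n,\;b+1,\;b-n-1\\ b-n,\;b-n+2\end{matrix}\,\Big|\,1\right)\right],$$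 with $S_0=0$ and, for $n\ge1$, $$S_n=\frac{q(n+1)\left(v-q(n+1)^2\right)(b+1)_n}{\left(v-q(n+1)\right)\left(2q(n+1)+v\right)(-b-1)_n}\;{}_3F_2\!\left(\begin{matrix}1-n,\;b+1,\;b\\ b+3,\;b-n\end{matrix}\,\Big|\,1\right),$$ is positive, and $N_n=B_n^{-1/2}$ satisfies $$N_n^2\int_{\log q}^\infty (1-qe^{-r})^2\,e^{-\left(\frac{v}{q(n+1)}-n-1\right)r}\left[{}_2F_1\!\left(-n,\,b+1;\,b-n;\,qe^{-r}\right)\right]^2dr=1,$$ where the integral converges absolutely. -/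

import Mathlib

noncomputable section

/-- The Pochhammer symbol `(a)_k = a (a + 1) ⋯ (a + k - 1)`. -/
def poch (a : ℝ) (k : ℕ) : ℝ := (ascPochhammer ℝ k).eval a

/-- The generalized hypergeometric series `₃F₂(a, b, c; d, e | x)`. -/
def threeFTwo (a b c d e x : ℝ) : ℝ :=
  ∑' k : ℕ, poch a k * poch b k * poch c k / (poch d k * poch e k * (k.factorial : ℝ)) * x ^ k

/-- The parameter `2μ / (q δ² (n + 1))`. -/
def hulthenParam (μ δ q : ℝ) (n : ℕ) : ℝ := 2 * μ / (q * δ ^ 2 * (n + 1))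

/-- The terminating factor `₂F₁(-n, 2μ/(qδ²(n+1)) + 1; 2μ/(qδ²(n+1)) - n; q e^{-δx})`. -/
def hulthenPoly (μ δ q : ℝ) (n : ℕ) (x : ℝ) : ℝ :=
  ordinaryHypergeometric (-(n : ℝ)) (hulthenParam μ δ q n + 1) (hulthenParam μ δ q n - n)
    (q * Real.exp (-(δ * x)))

/-- None of the denominators `(2μ/(qδ²(n+1)) - n)_k`, `k ≤ n`, of the terminating series vanishes. -/
def HulthenPolyDefined (μ δ q : ℝ) (n : ℕ) : Prop :=
  ∀ i < n, hulthenParam μ δ q n - n + i ≠ 0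

/-- The weighted product of the `n`-th and the `m`-th polynomial. -/
def hulthenOverlapIntegrand (μ δ q : ℝ) (n m : ℕ) (x : ℝ) : ℝ :=
  Real.exp (-((2 + m + n) * (2 * μ - q * δ ^ 2 * (1 + m) * (1 + n)) * x
      / (2 * δ * (1 + m) * (1 + n) * q)))
    * (1 - q * Real.exp (-(δ * x))) ^ 2
    * hulthenPoly μ δ q n x * hulthenPoly μ δ q m x

/-- The overlap integral `I_{nm}` over `(log q / δ, ∞)`. -/
def hulthenOverlap (μ δ q : ℝ) (n m : ℕ) : ℝ :=
  ∫ x in Set.Ioi (Real.log q / δ), hulthenOverlapIntegrand μ δ q n m x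

/-- The closed form of `I_{nn}`. The first `₃F₂` has numerator parameter `1 - n`; it terminates
for `n ≥ 1`, and its term is absent for `n = 0`. -/
def hulthenClosedForm (μ δ q : ℝ) (n : ℕ) : ℝ :=
  let a : ℝ := 2 * μ / (q * δ ^ 2 * (n + 1))
  2 * q ^ ((n : ℝ) + 1 - a) * Real.Gamma (a - n - 1) / (δ * Real.Gamma (a - n + 2)) *
    ((if n = 0 then 0 else
        q * δ ^ 2 * (n + 1) * (2 * μ - q * δ ^ 2 * (n + 1) ^ 2) * poch (a + 1) n
          / (2 * (2 * μ - q * δ ^ 2 * (n + 1)) * (q * δ ^ 2 * (n + 1) + μ) * poch (-a - 1) n)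
          * threeFTwo (1 - n) (a + 1) a (a + 3) (a - n) 1)
      + threeFTwo (-n) (a + 1) (a - n - 1) (a - n) (a - n + 2) 1)

/-- The eigenfunction `ψ_n`, with the constant `N` in front. -/
def hulthenPsi (μ δ q N : ℝ) (n : ℕ) (x : ℝ) : ℝ :=
  N * (1 - q * Real.exp (-(δ * x)))
    * Real.exp (-((μ / (q * δ * (n + 1)) - (n + 1) * δ / 2) * x))
    * hulthenPoly μ δ q n x

/-- The expression in braces in the closed form of the normalization constant of the problem
`-ψ'' - v e^{-r} / (1 - q e^{-r}) ψ = 𝓔 ψ` on `(log q, ∞)`, that is, for `δ = 1`, `v = 2μ`. -/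
def hulthenBraces (v q : ℝ) (n : ℕ) : ℝ :=
  let a : ℝ := v / (q * (n + 1))
  2 * q ^ ((n : ℝ) + 1 - a) * Real.Gamma (a - n - 1) / Real.Gamma (a - n + 2) *
    ((if n = 0 then 0 else
        q * (n + 1) * (v - q * (n + 1) ^ 2) * poch (a + 1) n
          / ((v - q * (n + 1)) * (2 * q * (n + 1) + v) * poch (-a - 1) n)
          * threeFTwo (1 - n) (a + 1) a (a + 3) (a - n) 1)
      + threeFTwo (-n) (a + 1) (a - n - 1) (a - n) (a - n + 2) 1)

/-- The normalization constant `N_n` for `δ = 1`, `v = 2μ`. -/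
def hulthenNormConst (v q : ℝ) (n : ℕ) : ℝ := hulthenBraces v q n ^ (-(1 / 2) : ℝ)

/-- The unnormalized `n`-th eigenfunction for `δ = 1`, `v = 2μ`, squared. -/
def hulthenUnitSq (v q : ℝ) (n : ℕ) (r : ℝ) : ℝ :=
  (1 - q * Real.exp (-r)) ^ 2 * Real.exp (-((v / (q * (n + 1)) - n - 1) * r))
    * ordinaryHypergeometric (-(n : ℝ)) (v / ((n + 1) * q) + 1) (v / ((n + 1) * q) - n)
        (q * Real.exp (-r)) ^ 2

end

noncomputable section

/-! Put t = q e^{-δx}, which carries the half-line to (0, 1), and κ_n = (a_n - n - 1)/2. Up to the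
factor q^{-(κ_n+κ_m)}/δ, I_{nm} is the integral of t^{κ_n+κ_m-1} (1-t)^2 f_n f_m over (0, 1).

Off the diagonal, a Wronskian argument applies. With θ = t d/dt, the function (1-t) t^{κ_n} f_n
solves θ²P = (κ_n² - A t/(1-t)) P, and A = 2μ/(qδ²) = (n+1) a_n does not depend on n. Hence (κ_n² -
κ_m²) times the integrand is an exact derivative. The Wronskian vanishes at t = 1 through (1-t)^2
and at t = 0 because κ_n + κ_m > 0 (`integral_eq_zero_of_ode`); only the sum has to be positive.

On the diagonal, write a = a_n, expand one factor as f_n = Σ c_j t^j and let M(s) be the integral of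
t^{s-1} (1-t) f_n. Row j contributes c_j (M(a-n-1+j) - M(a-n+j)). By Pfaff–Saalschütz, M(s) is
proportional to (s+1-a)_n, which vanishes at s = a-n, ..., a-1. For n ≥ 1 only row 0 and the corner
-c_n M(a) survive (`hypNormSq_eq`). Row 0 gives the second ₃F₂ of the closed form; the corner is
T_n, whose ₃F₂ is itself balanced and collapses to a product (`leading_term_eq`). -/

@[simp] lemma poch_zero (a : ℝ) : poch a 0 = 1 := by simp [poch]

lemma poch_succ (a : ℝ) (k : ℕ) : poch a (k + 1) = poch a k * (a + k) := by
  simp [poch, ascPochhammer_succ_eval]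

lemma poch_add (a : ℝ) (m k : ℕ) : poch a (m + k) = poch a m * poch (a + m) k := by
  induction k with
  | zero => simp
  | succ k ih => rw [← add_assoc, poch_succ, ih, poch_succ]; push_cast; ring

lemma poch_succ_left (a : ℝ) (k : ℕ) : poch a (k + 1) = a * poch (a + 1) k := by
  rw [add_comm, poch_add]; simp [poch]

lemma poch_pos {a : ℝ} (ha : 0 < a) (k : ℕ) : 0 < poch a k := ascPochhammer_pos k a ha

lemma poch_ne_zero {a : ℝ} {k : ℕ} (h : ∀ i < k, a + i ≠ 0) : poch a k ≠ 0 := by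
  induction k with
  | zero => simp
  | succ k ih =>
    rw [poch_succ]
    exact mul_ne_zero (ih fun i hi => h i (by lia)) (h k (by lia))

lemma poch_eq_zero {a : ℝ} {i k : ℕ} (hi : i < k) (h : a + i = 0) : poch a k = 0 := by
  obtain ⟨j, rfl⟩ := Nat.exists_eq_add_of_lt hi
  rw [add_assoc, poch_add, poch_succ_left, h]; simp

lemma poch_neg_natCast_of_lt {n k : ℕ} (h : n < k) : poch (-(n : ℝ)) k = 0 :=
  poch_eq_zero h (by simp)

/-- Reflection of the Pochhammer symbol. -/
lemma poch_reflect {x y : ℝ} {m : ℕ} (h : x + y = 1 - m) :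
    poch x m = (-1) ^ m * poch y m := by
  induction m generalizing x with
  | zero => simp
  | succ m ih =>
    rw [poch_succ_left, ih (x := x + 1) (by push_cast at h; linarith), poch_succ, pow_succ]
    have : x = -(y + m) := by push_cast at h; linarith
    rw [this]; ring

lemma poch_one (k : ℕ) : poch 1 k = (k.factorial : ℝ) := by
  simp [poch, ascPochhammer_eval_one]

lemma poch_two (k : ℕ) : poch 2 k = ((k + 1).factorial : ℝ) := by
  have := poch_succ_left 1 k
  rw [poch_one] at this; norm_num at this; exact this.symm

lemma poch_neg_natCast {n k : ℕ} (h : k ≤ n) :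
    poch (-(n : ℝ)) k = (-1) ^ k * (n.choose k : ℝ) * k.factorial := by
  induction k with
  | zero => simp
  | succ k ih =>
    have h1 := Nat.choose_succ_right_eq n k
    have h2 : ((n.choose (k + 1) : ℕ) : ℝ) * (k + 1) = n.choose k * (n - k) := by
      rw [← Nat.cast_sub (by lia : k ≤ n)]; exact_mod_cast h1
    rw [poch_succ, ih (by lia), Nat.factorial_succ, pow_succ]
    push_cast
    linear_combination (-1) ^ k * (k.factorial : ℝ) * h2

/-! ### Pfaff–Saalschütz summation -/

/-- The telescoped partial sums behind the Pfaff–Saalschütz identity. -/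
lemma saalschutz_partial (A B C : ℝ) (k r : ℕ) :
    ∑ j ∈ Finset.range (k + 1), ((k + r + 1).choose j : ℝ) * poch A j * poch B j
        * poch (C + j) (k + r + 1 - j) * poch (C - A - B) (k + r + 1 - j)
      = (C - A + (k + r : ℕ)) * (C - B + (k + r : ℕ))
          * ∑ j ∈ Finset.range (k + 1), ((k + r).choose j : ℝ) * poch A j * poch B j
              * poch (C + j) (k + r - j) * poch (C - A - B) (k + r - j)
        - ((k + r).choose k : ℝ) * poch A (k + 1) * poch B (k + 1)
            * poch (C + k) r * poch (C - A - B) r := by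
  induction k generalizing r with
  | zero => simp [poch_succ]; ring
  | succ k ih =>
    -- The upper index k + r stays fixed while k grows, so the induction hypothesis is used at r +
    -- 1.
    have e : k + 1 + r = k + (r + 1) := by ring
    rw [Finset.sum_range_succ, Finset.sum_range_succ _ (k + 1), e, ih (r + 1)]
    have hK : (k + (r + 1) + 1 - (k + 1)) = r + 1 := by lia
    have hK' : (k + (r + 1) - (k + 1)) = r := by lia
    rw [hK, hK', poch_succ A (k + 1), poch_succ B (k + 1), poch_succ (C + (k + 1 : ℕ)) r,
      poch_succ_left (C + k) r, poch_succ (C - A - B) r]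
    have h2 : (((k + (r + 1)).choose (k + 1) : ℕ) : ℝ) * (k + 1)
        = (k + (r + 1)).choose k * (r + 1) := by
      have := Nat.choose_succ_right_eq (k + (r + 1)) k
      rw [Nat.add_sub_cancel_left] at this
      exact_mod_cast this
    have h3 : (((k + (r + 1) + 1).choose (k + 1) : ℕ) : ℝ)
        = (k + (r + 1)).choose k + (k + (r + 1)).choose (k + 1) := by
      exact_mod_cast Nat.choose_succ_succ _ _
    rw [h3, show C + ((k + 1 : ℕ) : ℝ) = C + k + 1 by push_cast; ring]
    push_cast
    linear_combination (-(C - A - B + r)) * poch A (k + 1) * poch B (k + 1)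
      * poch (C + k + 1) r * poch (C - A - B) r * h2

/-- The Pfaff–Saalschütz identity, cleared of denominators. -/
lemma saalschutz_poly (A B C : ℝ) (n : ℕ) :
    ∑ j ∈ Finset.range (n + 1), (n.choose j : ℝ) * poch A j * poch B j
        * poch (C + j) (n - j) * poch (C - A - B) (n - j)
      = poch (C - A) n * poch (C - B) n := by
  induction n with
  | zero => simp
  | succ n ih =>
    -- At r = 0 the boundary term of the telescoping is exactly the missing last summand j = n + 1,
    -- leaving a first-order recurrence in n.
    have h := saalschutz_partial A B C n 0
    simp only [add_zero] at h
    rw [Finset.sum_range_succ, h, ih, poch_succ (C - A), poch_succ (C - B)]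
    simp
    ring

/-- The Pfaff–Saalschütz summation of a balanced terminating `₃F₂` at `1`. -/
lemma saalschutz {A B C D : ℝ} {n : ℕ} (hD : C + D = 1 + A + B - n)
    (hC0 : poch C n ≠ 0) (hD0 : poch D n ≠ 0) :
    ∑ k ∈ Finset.range (n + 1), poch (-(n : ℝ)) k * poch A k * poch B k
        / (poch C k * poch D k * (k.factorial : ℝ))
      = (-1) ^ n * poch (C - A) n * poch (C - B) n / (poch C n * poch D n) := by
  rw [eq_div_iff (mul_ne_zero hC0 hD0), mul_assoc, ← saalschutz_poly A B C n, Finset.sum_mul,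
    Finset.mul_sum]
  refine Finset.sum_congr rfl fun k hk => ?_
  obtain ⟨r, rfl⟩ := Nat.exists_eq_add_of_le (Nat.lt_succ_iff.mp (Finset.mem_range.mp hk))
  rw [poch_add] at hC0 hD0
  -- The balancing condition reads C - A - B = 1 - n - D, so reflection turns the tail (D + k)_{n-k}
  -- into (C - A - B)_{n-k}.
  rw [poch_neg_natCast (by lia), poch_add C, poch_add D, Nat.add_sub_cancel_left,
    poch_reflect (x := C - A - B) (y := D + k) (m := r) (by push_cast at hD; linarith)]
  have hk0 : (k.factorial : ℝ) ≠ 0 := by positivity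
  have hCk := left_ne_zero_of_mul hC0
  have hDk := left_ne_zero_of_mul hD0
  have hs : ((-1 : ℝ) ^ r) * (-1) ^ r = 1 := by rw [← mul_pow]; norm_num
  rw [div_mul_eq_mul_div, div_eq_iff (by positivity), pow_add]
  linear_combination (-(-1) ^ k * ((k + r).choose k : ℝ) * k.factorial * poch A k * poch B k * poch C k
    * poch (C + k) r * poch D k * poch (D + k) r) * hs

/-! ### Coefficients, moments and the termwise norm -/

lemma threeFTwo_neg_natCast (n : ℕ) (b c d e : ℝ) :
    threeFTwo (-(n : ℝ)) b c d e 1 = ∑ k ∈ Finset.range (n + 1),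
      poch (-(n : ℝ)) k * poch b k * poch c k / (poch d k * poch e k * (k.factorial : ℝ)) := by
  unfold threeFTwo
  rw [tsum_eq_sum (s := Finset.range (n + 1))]
  · simp
  · intro k hk
    rw [poch_neg_natCast_of_lt (by simpa using hk)]
    simp

/-- The coefficients of the terminating series `₂F₁(-n, a + 1; a - n; t)`. -/
def hypCoeff (a : ℝ) (n k : ℕ) : ℝ :=
  poch (-(n : ℝ)) k * poch (a + 1) k / (poch (a - n) k * (k.factorial : ℝ))

@[simp] lemma hypCoeff_zero (a : ℝ) (n : ℕ) : hypCoeff a n 0 = 1 := by simp [hypCoeff]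

lemma hypCoeff_of_lt (a : ℝ) {n k : ℕ} (h : n < k) : hypCoeff a n k = 0 := by
  simp [hypCoeff, poch_neg_natCast_of_lt h]

lemma hypCoeff_self (a : ℝ) (n : ℕ) :
    hypCoeff a n n = (-1) ^ n * poch (a + 1) n / poch (a - n) n := by
  have : (n.factorial : ℝ) ≠ 0 := by positivity
  rw [hypCoeff, poch_neg_natCast le_rfl]
  simp
  field_simp

/-- The term ratio of the series. It persists for k ≥ n: at k = n the factor k - n vanishes, and
every coefficient beyond n is zero through its numerator, whatever the denominator is. -/
lemma hypCoeff_succ {a : ℝ} {n : ℕ} (h : ∀ i < n, a - n + i ≠ 0) (k : ℕ) :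
    (k + 1) * (a - n + k) * hypCoeff a n (k + 1) = (k - n) * (a + 1 + k) * hypCoeff a n k := by
  rcases lt_trichotomy k n with hk | hk | hk
  · have h1 : poch (a - n) k ≠ 0 := poch_ne_zero fun i hi => h i (by lia)
    have h2 := h k hk
    have h3 : (k.factorial : ℝ) ≠ 0 := by positivity
    have h4 : (k : ℝ) + 1 ≠ 0 := by positivity
    rw [hypCoeff, hypCoeff, poch_succ, poch_succ, poch_succ, Nat.factorial_succ]
    push_cast
    field_simp
    ring
  · rw [hypCoeff_of_lt a (by lia : n < k + 1), hk]; simp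
  · rw [hypCoeff_of_lt a hk, hypCoeff_of_lt a (by lia : n < k + 1)]; simp

/-- Both sides are (s)_{k+2}, split after k or after 2 factors. -/
lemma poch_mul_shift_two (s : ℝ) (k : ℕ) :
    poch s k * ((s + k) * (s + k + 1)) = s * (s + 1) * poch (s + 2) k := by
  have h := poch_add s 2 k
  rw [add_comm, poch_add] at h
  simp only [poch_succ, poch_zero] at h
  norm_num at h
  linear_combination h

lemma poch_div_poch_add_two {s : ℝ} (hs : 0 < s) (k : ℕ) :
    poch s k / poch (s + 2) k = s * (s + 1) / ((s + k) * (s + k + 1)) := by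
  have := poch_pos (a := s + 2) (by linarith) k
  rw [div_eq_div_iff (by positivity) (by positivity), poch_mul_shift_two]

lemma poch_div_poch_add_three {s : ℝ} (hs : 0 < s) (k : ℕ) :
    poch s k / poch (s + 3) k
      = s * (s + 1) * (s + 2) / ((s + k) * (s + k + 1) * (s + k + 2)) := by
  have h1 : poch s k * ((s + k) * (s + k + 1) * (s + k + 2))
      = s * (s + 1) * (s + 2) * poch (s + 3) k := by
    have h := poch_add s 3 k
    rw [add_comm, poch_add] at h
    simp only [poch_succ, poch_zero] at h
    norm_num at h
    linear_combination h
  have := poch_pos (a := s + 3) (by linarith) k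
  rw [div_eq_div_iff (by positivity) (by positivity), h1]

/-- The moment `∫₀¹ t ^ (s - 1) (1 - t) ₂F₁(-n, a + 1; a - n; t) dt`, integrated termwise. -/
def hypMoment (a : ℝ) (n : ℕ) (s : ℝ) : ℝ :=
  ∑ k ∈ Finset.range (n + 1), hypCoeff a n k / ((s + k) * (s + k + 1))

lemma hypMoment_eq {a s : ℝ} {n : ℕ} (ha : (n : ℝ) < a) (hs : 0 < s) :
    hypMoment a n s = (-1) ^ n * poch (s + 1 - a) n * (n + 1).factorial
      / (s * (s + 1) * (poch (s + 2) n * poch (a - n) n)) := by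
  have hC := (poch_pos (a := s + 2) (by linarith) n).ne'
  have hD := (poch_pos (a := a - n) (by linarith) n).ne'
  have h := saalschutz (A := a + 1) (B := s) (C := s + 2) (D := a - n) (n := n) (by ring) hC hD
  rw [show s + 2 - (a + 1) = s + 1 - a by ring, show s + 2 - s = 2 by ring, poch_two] at h
  rw [mul_comm (s * (s + 1)), ← div_div, ← h, hypMoment, Finset.sum_div]
  refine Finset.sum_congr rfl fun k _ => ?_
  have hk := poch_div_poch_add_two hs k
  rw [show poch (-(n : ℝ)) k * poch (a + 1) k * poch s k
      / (poch (s + 2) k * poch (a - n) k * (k.factorial : ℝ))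
      = hypCoeff a n k * (poch s k / poch (s + 2) k) by
    rw [hypCoeff, div_mul_div_comm]; congr 1; ring, hk]
  field_simp

/-- At s = a - n + j the product (s + 1 - a)_n contains a zero factor, the one of index n - 1 - j.
-/
lemma hypMoment_eq_zero {a : ℝ} {n j : ℕ} (ha : (n : ℝ) < a) (hj : j < n) :
    hypMoment a n (a - n + j) = 0 := by
  rw [hypMoment_eq ha (by have : (0 : ℝ) ≤ j := by positivity
                          linarith),
    poch_eq_zero (i := n - 1 - j) (by lia : n - 1 - j < n)]
  · simp
  · rw [Nat.cast_sub (by lia), Nat.cast_sub (by lia)]; push_cast; ring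

lemma hypMoment_self {a : ℝ} {n : ℕ} (ha : (n : ℝ) < a) :
    hypMoment a n a = (-1) ^ n * n.factorial * (n + 1).factorial
      / (a * (a + 1) * (poch (a + 2) n * poch (a - n) n)) := by
  rw [hypMoment_eq ha (by have : (0 : ℝ) ≤ n := by positivity
                          linarith), show a + 1 - a = 1 by ring, poch_one]

/-- The termwise value of `∫₀¹ t ^ (a - n - 2) (1 - t) ^ 2 ₂F₁(-n, a + 1; a - n; t) ^ 2 dt`. -/
def hypNormSq (a : ℝ) (n : ℕ) : ℝ :=
  ∑ j ∈ Finset.range (n + 1), ∑ k ∈ Finset.range (n + 1), hypCoeff a n j * hypCoeff a n k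
    * (2 / ((a - n - 1 + (j + k : ℕ)) * (a - n - 1 + (j + k : ℕ) + 1)
        * (a - n - 1 + (j + k : ℕ) + 2)))

lemma hypNormSq_eq {a : ℝ} {n : ℕ} (ha : (n : ℝ) + 1 < a) :
    hypNormSq a n = (if n = 0 then 0 else -(hypCoeff a n n * hypMoment a n a))
      + 2 / ((a - n - 1) * (a - n) * (a - n + 1))
        * threeFTwo (-(n : ℝ)) (a + 1) (a - n - 1) (a - n) (a - n + 2) 1 := by
  -- Termwise form of (1-t)^2 = (1-t) - t(1-t): each row is a difference of two consecutive moments.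
  have hinner (j : ℕ) : ∑ k ∈ Finset.range (n + 1), hypCoeff a n j * hypCoeff a n k
      * (2 / ((a - n - 1 + (j + k : ℕ)) * (a - n - 1 + (j + k : ℕ) + 1)
        * (a - n - 1 + (j + k : ℕ) + 2)))
      = hypCoeff a n j * (hypMoment a n (a - n - 1 + j) - hypMoment a n (a - n + j)) := by
    rw [hypMoment, hypMoment, ← Finset.sum_sub_distrib, Finset.mul_sum]
    refine Finset.sum_congr rfl fun k _ => ?_
    have h0 : (0 : ℝ) < a - n - 1 := by linarith
    have h1 : (0 : ℝ) < a - n - 1 + (j + k : ℕ) := by positivity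
    have e1 : a - n - 1 + (j : ℝ) + k = a - n - 1 + (j + k : ℕ) := by push_cast; ring
    have e2 : a - n + (j : ℝ) + k = a - n - 1 + (j + k : ℕ) + 1 := by push_cast; ring
    rw [e1, e2]
    generalize a - n - 1 + ((j + k : ℕ) : ℝ) = s at h1
    have : s + 1 ≠ 0 := by positivity
    have : s + 2 ≠ 0 := by positivity
    have : s + 1 + 1 ≠ 0 := by positivity
    field_simp
    ring
  have hzero : ∑ k ∈ Finset.range (n + 1), hypCoeff a n 0 * hypCoeff a n k
      * (2 / ((a - n - 1 + (0 + k : ℕ)) * (a - n - 1 + (0 + k : ℕ) + 1)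
        * (a - n - 1 + (0 + k : ℕ) + 2)))
      = 2 / ((a - n - 1) * (a - n) * (a - n + 1))
        * threeFTwo (-(n : ℝ)) (a + 1) (a - n - 1) (a - n) (a - n + 2) 1 := by
    rw [threeFTwo_neg_natCast, Finset.mul_sum]
    refine Finset.sum_congr rfl fun k _ => ?_
    have h0 : (0 : ℝ) < a - n - 1 := by linarith
    have hk := poch_div_poch_add_three h0 k
    rw [show a - n - 1 + 3 = a - n + 2 by ring] at hk
    rw [show poch (-(n : ℝ)) k * poch (a + 1) k * poch (a - n - 1) k
        / (poch (a - n) k * poch (a - n + 2) k * (k.factorial : ℝ))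
        = hypCoeff a n k * (poch (a - n - 1) k / poch (a - n + 2) k) by
      rw [hypCoeff, div_mul_div_comm]; congr 1; ring, hk, hypCoeff_zero, zero_add]
    have h1 : (0 : ℝ) < a - n - 1 + k := by positivity
    rw [show a - n = a - n - 1 + 1 by ring, show a - n - 1 + 1 + 1 = a - n - 1 + 2 by ring]
    simp only [add_sub_cancel_right]
    generalize a - n - 1 = s at h0 h1
    have : s + k + 1 ≠ 0 := by positivity
    have : s + k + 2 ≠ 0 := by positivity
    have : s + 1 ≠ 0 := by positivity
    have : s + 2 ≠ 0 := by positivity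
    field_simp
  rw [hypNormSq, Finset.sum_range_succ', hzero]
  congr 1
  simp only [hinner]
  -- For n = 0 the corner lies in row 0, already counted, so there is no extra term.
  cases n with
  | zero => simp
  | succ m =>
    have hz1 (j : ℕ) (hj : j < m + 1) :
        hypMoment a (m + 1) (a - (m + 1 : ℕ) - 1 + (j + 1 : ℕ)) = 0 := by
      rw [← hypMoment_eq_zero (j := j) (by linarith : ((m + 1 : ℕ) : ℝ) < a) hj]
      congr 1; push_cast; ring
    have hz2 (j : ℕ) (hj : j < m) :
        hypMoment a (m + 1) (a - (m + 1 : ℕ) + (j + 1 : ℕ)) = 0 :=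
      hypMoment_eq_zero (by linarith) (by lia)
    rw [Finset.sum_range_succ, Finset.sum_eq_zero, hz1 m (by lia), if_neg (by lia)]
    · rw [show a - ((m + 1 : ℕ) : ℝ) + (m + 1 : ℕ) = a by ring]; ring
    · intro j hj
      rw [hz1 j (by have := Finset.mem_range.mp hj; lia), hz2 j (Finset.mem_range.mp hj)]
      simp

/-- The balanced `₃F₂` of the closed form, summed by the Pfaff–Saalschütz identity. -/
lemma threeFTwo_one_sub {a : ℝ} {m : ℕ} (ha : (m : ℝ) + 2 < a) :
    threeFTwo (1 - (m + 1 : ℕ)) (a + 1) a (a + 3) (a - (m + 1 : ℕ)) 1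
      = (-1) ^ m * (m + 1).factorial * ((m + 2).factorial / 2)
          / (poch (a + 3) m * poch (a - (m + 1 : ℕ)) m) := by
  have hm : (0 : ℝ) ≤ m := by positivity
  have hC := (poch_pos (a := a + 3) (by linarith) m).ne'
  have hD := (poch_pos (a := a - (m + 1 : ℕ)) (by push_cast; linarith) m).ne'
  have h3 : poch 3 m = (m + 2).factorial / 2 := by
    have := poch_succ_left 2 m
    rw [poch_two] at this; norm_num at this
    rw [show m + 2 = m + 1 + 1 by ring, this]; ring
  rw [show (1 : ℝ) - (m + 1 : ℕ) = -(m : ℝ) by push_cast; ring, threeFTwo_neg_natCast,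
    saalschutz (by push_cast; ring) hC hD, show a + 3 - (a + 1) = 2 by ring,
    show a + 3 - a = 3 by ring, poch_two, h3]

/-- Identifies the corner term with T_n: once both Saalschütz sums are inserted, the two sides are
products of Pochhammer symbols that agree after reflection and index shifts. -/
lemma leading_term_eq {a : ℝ} {m : ℕ} (ha : (m : ℝ) + 2 < a) :
    -(hypCoeff a (m + 1) (m + 1) * hypMoment a (m + 1) a)
      = 2 / ((a - (m + 1 : ℕ) - 1) * (a - (m + 1 : ℕ)) * (a - (m + 1 : ℕ) + 1))
        * ((a - (m + 1 : ℕ) - 1) * poch (a + 1) (m + 1)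
            / ((a - 1) * (a + 2) * poch (-a - 1) (m + 1))
          * threeFTwo (1 - (m + 1 : ℕ)) (a + 1) a (a + 3) (a - (m + 1 : ℕ)) 1) := by
  have hm : (0 : ℝ) ≤ m := by positivity
  have hr : poch (-a - 1) (m + 1) = (-1) ^ (m + 1) * poch (a - (m + 1 : ℕ) + 2) (m + 1) :=
    poch_reflect (by push_cast; ring)
  have e1 : poch (a - (m + 1 : ℕ)) (m + 1) * (a * (a + 1))
      = (a - (m + 1 : ℕ)) * (a - (m + 1 : ℕ) + 1) * poch (a - (m + 1 : ℕ) + 2) (m + 1) := by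
    rw [← poch_mul_shift_two]; push_cast; ring
  have e2 : poch (a - (m + 1 : ℕ)) (m + 1) = poch (a - (m + 1 : ℕ)) m * (a - 1) := by
    rw [poch_succ]; push_cast; ring
  have e3 : poch (a + 2) (m + 1) = (a + 2) * poch (a + 3) m := by
    rw [poch_succ_left]; ring_nf
  rw [threeFTwo_one_sub ha, hypCoeff_self, hypMoment_self (by push_cast; linarith), hr, e3]
  have p1 := (poch_pos (a := a + 3) (by linarith) m).ne'
  have p2 := (poch_pos (a := a - (m + 1 : ℕ)) (by push_cast; linarith) m).ne'
  have p3 := (poch_pos (a := a - (m + 1 : ℕ) + 2) (by push_cast; linarith) (m + 1)).ne'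
  have q0 : a - (m + 1 : ℕ) - 1 ≠ 0 := by push_cast; linarith
  have q1 : a - (m + 1 : ℕ) ≠ 0 := by push_cast; linarith
  have q2 : a - (m + 1 : ℕ) + 1 ≠ 0 := by push_cast; linarith
  have q3 : a - 1 ≠ 0 := by linarith
  have q4 : a + 2 ≠ 0 := by linarith
  have q5 : a ≠ 0 := by linarith
  have q6 : a + 1 ≠ 0 := by linarith
  have hs : ((-1 : ℝ) ^ m) ^ 2 = 1 := by rw [← pow_mul, mul_comm, pow_mul]; norm_num
  have hs' : (-1 : ℝ) ^ m ≠ 0 := by positivity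
  rw [pow_succ (-1 : ℝ) m]
  rw [e2] at e1 ⊢
  generalize poch (a - (m + 1 : ℕ)) m = x at *
  generalize poch (a + 3) m = z at *
  generalize poch (a + 1) (m + 1) = w at *
  generalize a - (m + 1 : ℕ) = u at *
  have hy := eq_div_of_mul_eq (mul_ne_zero q1 q2) (by rw [mul_comm, ← e1])
  rw [hy]
  field_simp
  rw [hs, one_mul]

/-! ### The terminating series as a polynomial, and its differential equation -/

open Polynomial in
/-- The terminating series `₂F₁(-n, a + 1; a - n; t)` as a polynomial in `t`. -/
def hypPoly (a : ℝ) (n : ℕ) : ℝ[X] :=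
  ∑ k ∈ Finset.range (n + 1), C (hypCoeff a n k) * X ^ k

lemma hypPoly_coeff (a : ℝ) (n k : ℕ) : (hypPoly a n).coeff k = hypCoeff a n k := by
  simp only [hypPoly, Polynomial.finsetSum_coeff, Polynomial.coeff_C_mul_X_pow]
  rw [Finset.sum_ite_eq]
  split_ifs with h
  · rfl
  · exact (hypCoeff_of_lt a (by simpa using h)).symm

lemma hypPoly_eval (a : ℝ) (n : ℕ) (t : ℝ) :
    (hypPoly a n).eval t = ∑ k ∈ Finset.range (n + 1), hypCoeff a n k * t ^ k := by
  simp [hypPoly, Polynomial.eval_finsetSum]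

/-- No condition on a is needed: terms beyond n have zero numerator, and both sides invert a
vanishing denominator to the same default value 0. -/
lemma ordinaryHypergeometric_eq_hypPoly (a : ℝ) (n : ℕ) (t : ℝ) :
    ordinaryHypergeometric (-(n : ℝ)) (a + 1) (a - n) t = (hypPoly a n).eval t := by
  have h (k : ℕ) : ((k.factorial : ℝ)⁻¹ * (ascPochhammer ℝ k).eval (-(n : ℝ))
      * (ascPochhammer ℝ k).eval (a + 1) * ((ascPochhammer ℝ k).eval (a - n))⁻¹) • t ^ k
      = hypCoeff a n k * t ^ k := by
    simp only [hypCoeff, poch, smul_eq_mul, div_eq_mul_inv, mul_inv]; ring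
  rw [ordinaryHypergeometric_eq_tsum, hypPoly_eval]
  simp only [h]
  exact tsum_eq_sum fun k hk => by
    rw [hypCoeff_of_lt a (by simpa using hk), zero_mul]

open Polynomial in
/-- The hypergeometric differential equation of the terminating series. -/
lemma hypPoly_ode {a : ℝ} {n : ℕ} (h : ∀ i < n, a - n + i ≠ 0) (t : ℝ) :
    (1 - t) * (t * (derivative (derivative (hypPoly a n))).eval t
        + (a - n) * (derivative (hypPoly a n)).eval t)
      - 2 * t * (derivative (hypPoly a n)).eval t + n * (a + 1) * (hypPoly a n).eval t = 0 := by
  set p := hypPoly a n with hp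
  -- The equation sorted by degree, so that comparing coefficients of X^k gives `hypCoeff_succ`; k =
  -- 0 and k = 1 are separate because of the factors X.
  have key : X * derivative (derivative p) + C (a - n) * derivative p
      + C (n * (a + 1)) * p = X * (X * derivative (derivative p))
      + C (a - n + 2) * (X * derivative p) := by
    ext k
    have hr := hypCoeff_succ h
    rcases k with _ | _ | k
    · have := hr 0
      simp [coeff_derivative, hp, hypPoly_coeff] at this ⊢
      linear_combination this
    · have := hr 1
      simp only [coeff_add, coeff_C_mul, coeff_X_mul, coeff_X_mul_zero, coeff_derivative, hp,
        hypPoly_coeff]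
      push_cast at this ⊢
      linear_combination this
    · have := hr (k + 2)
      simp only [coeff_add, coeff_C_mul, coeff_X_mul, coeff_derivative, hp, hypPoly_coeff]
      push_cast at this ⊢
      linear_combination this
  have := congrArg (eval t) key
  simp only [eval_add, eval_mul, eval_X, eval_C] at this
  linear_combination this

/-! ### Integrals over the half-line and the Wronskian argument -/

section Integrals

open MeasureTheory Set Filter Topology

variable {δ q s : ℝ}

lemma exp_mul_pow_eq (s δ q : ℝ) (k : ℕ) (x : ℝ) :
    Real.exp (-(s * δ * x)) * (q * Real.exp (-(δ * x))) ^ k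
      = q ^ k * Real.exp (-((s + k) * δ) * x) := by
  rw [mul_pow, ← Real.exp_nat_mul, mul_left_comm, ← Real.exp_add]
  congr 2; ring

lemma integrableOn_exp_mul_pow (hδ : 0 < δ) (hs : 0 < s) (k : ℕ) :
    IntegrableOn (fun x => Real.exp (-(s * δ * x)) * (q * Real.exp (-(δ * x))) ^ k)
      (Ioi (Real.log q / δ)) := by
  simp only [exp_mul_pow_eq]
  have : 0 < (s + k) * δ := by positivity
  exact (integrableOn_exp_mul_Ioi (by linarith) _).const_mul _

/-- This is the integral of t^{s+k-1} over (0, 1), with e^{-sδx} = q^{-s} t^s accounting for the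
prefactor. -/
lemma integral_exp_mul_pow (hδ : 0 < δ) (hq : 0 < q) (hs : 0 < s) (k : ℕ) :
    ∫ x in Ioi (Real.log q / δ), Real.exp (-(s * δ * x)) * (q * Real.exp (-(δ * x))) ^ k
      = q ^ (-s) / δ * (1 / (s + k)) := by
  simp only [exp_mul_pow_eq]
  have h0 : 0 < s + k := by positivity
  have h : 0 < (s + k) * δ := by positivity
  rw [integral_const_mul, integral_exp_mul_Ioi (by linarith),
    show -((s + k) * δ) * (Real.log q / δ) = Real.log q * -s + Real.log q * -k by
      field_simp; ring, Real.exp_add, ← Real.rpow_def_of_pos hq, ← Real.rpow_def_of_pos hq,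
    Real.rpow_neg hq.le k, Real.rpow_natCast]
  field_simp

lemma integrableOn_exp_mul_eval (hδ : 0 < δ) (hs : 0 < s) (p : Polynomial ℝ) :
    IntegrableOn (fun x => Real.exp (-(s * δ * x)) * p.eval (q * Real.exp (-(δ * x))))
      (Ioi (Real.log q / δ)) := by
  simp only [Polynomial.eval_eq_sum_range, Finset.mul_sum]
  refine integrable_finsetSum _ fun k _ => ?_
  simp only [mul_left_comm _ (p.coeff k)]
  exact (integrableOn_exp_mul_pow hδ hs k).const_mul _

lemma integral_exp_mul_sq_mul_pow (hδ : 0 < δ) (hq : 0 < q) (hs : 0 < s) (k : ℕ) :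
    ∫ x in Ioi (Real.log q / δ), Real.exp (-(s * δ * x)) * ((1 - q * Real.exp (-(δ * x))) ^ 2
        * (q * Real.exp (-(δ * x))) ^ k)
      = q ^ (-s) / δ * (2 / ((s + k) * (s + k + 1) * (s + k + 2))) := by
  have e (x : ℝ) : Real.exp (-(s * δ * x)) * ((1 - q * Real.exp (-(δ * x))) ^ 2
        * (q * Real.exp (-(δ * x))) ^ k)
      = Real.exp (-(s * δ * x)) * (q * Real.exp (-(δ * x))) ^ k
        - 2 * (Real.exp (-(s * δ * x)) * (q * Real.exp (-(δ * x))) ^ (k + 1))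
        + Real.exp (-(s * δ * x)) * (q * Real.exp (-(δ * x))) ^ (k + 2) := by ring
  have hi (k : ℕ) := integrableOn_exp_mul_pow (q := q) hδ hs k
  have hsub : IntegrableOn (fun x => Real.exp (-(s * δ * x)) * (q * Real.exp (-(δ * x))) ^ k
      - 2 * (Real.exp (-(s * δ * x)) * (q * Real.exp (-(δ * x))) ^ (k + 1)))
      (Ioi (Real.log q / δ)) := (hi k).sub ((hi (k + 1)).const_mul 2)
  simp only [e]
  rw [integral_add hsub (hi (k + 2)),
    integral_sub (hi k) ((hi (k + 1)).const_mul 2), integral_const_mul]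
  simp only [integral_exp_mul_pow hδ hq hs]
  have h0 : s + k ≠ 0 := by positivity
  have h1 : s + k + 1 ≠ 0 := by positivity
  have h2 : s + k + 2 ≠ 0 := by positivity
  push_cast
  rw [← add_assoc, ← add_assoc]
  field_simp
  ring

/-- The squared norm of a terminating hypergeometric factor is the termwise one. -/
lemma integral_hypPoly_sq {a : ℝ} {n : ℕ} (hδ : 0 < δ) (hq : 0 < q) (ha : (n : ℝ) + 1 < a) :
    ∫ x in Ioi (Real.log q / δ), Real.exp (-((a - n - 1) * δ * x))
        * ((1 - q * Real.exp (-(δ * x))) ^ 2 * (hypPoly a n).eval (q * Real.exp (-(δ * x))) ^ 2)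
      = q ^ (-(a - n - 1)) / δ * hypNormSq a n := by
  have hs : 0 < a - n - 1 := by linarith
  have e (x : ℝ) : Real.exp (-((a - n - 1) * δ * x)) * ((1 - q * Real.exp (-(δ * x))) ^ 2
        * (hypPoly a n).eval (q * Real.exp (-(δ * x))) ^ 2)
      = ∑ j ∈ Finset.range (n + 1), ∑ k ∈ Finset.range (n + 1), hypCoeff a n j * hypCoeff a n k
        * (Real.exp (-((a - n - 1) * δ * x)) * ((1 - q * Real.exp (-(δ * x))) ^ 2
          * (q * Real.exp (-(δ * x))) ^ (j + k))) := by
    rw [hypPoly_eval, sq (∑ k ∈ _, _), Finset.sum_mul_sum]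
    simp only [Finset.mul_sum]
    refine Finset.sum_congr rfl fun j _ => Finset.sum_congr rfl fun k _ => ?_
    ring
  have hi (k : ℕ) : IntegrableOn (fun x => Real.exp (-((a - n - 1) * δ * x))
      * ((1 - q * Real.exp (-(δ * x))) ^ 2 * (q * Real.exp (-(δ * x))) ^ k))
      (Ioi (Real.log q / δ)) := by
    refine (integrableOn_exp_mul_eval hδ hs ((1 - Polynomial.X) ^ 2 * Polynomial.X ^ k)).congr_fun
      (fun x _ => ?_) measurableSet_Ioi
    simp
  simp only [e]
  rw [integral_finsetSum _ fun j _ => integrable_finsetSum _ fun k _ => (hi (j + k)).const_mul _,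
    hypNormSq, Finset.mul_sum]
  refine Finset.sum_congr rfl fun j _ => ?_
  rw [integral_finsetSum _ fun k _ => (hi (j + k)).const_mul _, Finset.mul_sum]
  refine Finset.sum_congr rfl fun k _ => ?_
  rw [integral_const_mul, integral_exp_mul_sq_mul_pow hδ hq hs, mul_left_comm]

open Polynomial in
/-- Two solutions of the same Sturm–Liouville problem with different eigenvalues are orthogonal. -/
lemma integral_eq_zero_of_ode {κ ν A : ℝ} (hδ : 0 < δ) (hq : 0 < q) (hs : 0 < κ + ν)
    (hne : κ ≠ ν) {p r : ℝ[X]}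
    (hp : ∀ t, (1 - t) * (t * (derivative (derivative p)).eval t
        + (2 * κ + 1) * (derivative p).eval t)
      - 2 * t * (derivative p).eval t + (A - 2 * κ - 1) * p.eval t = 0)
    (hr : ∀ t, (1 - t) * (t * (derivative (derivative r)).eval t
        + (2 * ν + 1) * (derivative r).eval t)
      - 2 * t * (derivative r).eval t + (A - 2 * ν - 1) * r.eval t = 0) :
    ∫ x in Ioi (Real.log q / δ), Real.exp (-((κ + ν) * δ * x))
        * ((1 - X) ^ 2 * p * r).eval (q * Real.exp (-(δ * x))) = 0 := by
  -- Up to a power of q, e^{-(κ+ν)δx} V is the θ-Wronskian of (1-t) t^κ p and (1-t) t^ν r; d/dx = -δ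
  -- θ gives the factor -δ below.
  set V : ℝ[X] := (1 - X) ^ 2 * (C (κ - ν) * p * r + X * (derivative p * r - p * derivative r))
    with hV
  have hder (x : ℝ) : HasDerivAt
      (fun x => Real.exp (-((κ + ν) * δ * x)) * V.eval (q * Real.exp (-(δ * x))))
      (-δ * (κ ^ 2 - ν ^ 2) * (Real.exp (-((κ + ν) * δ * x))
        * ((1 - X) ^ 2 * p * r).eval (q * Real.exp (-(δ * x))))) x := by
    have h1 : HasDerivAt (fun x => Real.exp (-((κ + ν) * δ * x)))
        (Real.exp (-((κ + ν) * δ * x)) * -((κ + ν) * δ * 1)) x :=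
      (((hasDerivAt_id x).const_mul _).neg).exp
    have h2 : HasDerivAt (fun x => q * Real.exp (-(δ * x)))
        (q * (Real.exp (-(δ * x)) * -(δ * 1))) x :=
      ((((hasDerivAt_id x).const_mul _).neg).exp).const_mul q
    have h3 := h1.mul ((V.hasDerivAt (q * Real.exp (-(δ * x)))).comp x h2)
    refine h3.congr_deriv ?_
    have hp' := hp (q * Real.exp (-(δ * x)))
    have hr' := hr (q * Real.exp (-(δ * x)))
    simp only [Function.comp, hV, derivative_mul, derivative_add, derivative_sub, derivative_X,
      derivative_C, derivative_one, derivative_pow, eval_add, eval_mul, eval_sub, eval_pow,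
      eval_X, eval_C, eval_one]
    rw [show q * (Real.exp (-(δ * x)) * -(δ * 1)) = -δ * (q * Real.exp (-(δ * x))) by ring]
    generalize q * Real.exp (-(δ * x)) = t at *
    simp only [Nat.cast_ofNat, Nat.add_one_sub_one, pow_one, eval_zero]
    linear_combination -δ * Real.exp (-((κ + ν) * δ * x)) * (1 - t) * t
      * (r.eval t * hp' - p.eval t * hr')
  have hlim : Tendsto (fun x => Real.exp (-((κ + ν) * δ * x)) * V.eval (q * Real.exp (-(δ * x))))
      atTop (𝓝 0) := by
    have h1 {c : ℝ} (hc : 0 < c) : Tendsto (fun x : ℝ => Real.exp (-(c * x))) atTop (𝓝 0) :=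
      Real.tendsto_exp_neg_atTop_nhds_zero.comp (tendsto_id.const_mul_atTop hc)
    have h2 := (h1 hδ).const_mul q
    have h3 := (h1 (mul_pos hs hδ)).mul ((V.continuous.tendsto _).comp h2)
    simpa using h3
  have h := integral_Ioi_of_hasDerivAt_of_tendsto' (a := Real.log q / δ) (fun x _ => hder x)
    ((integrableOn_exp_mul_eval hδ hs _).const_mul _) hlim
  -- The left endpoint is t = 1, where (1-t)^2 kills the boundary term.
  have ht1 : q * Real.exp (-(δ * (Real.log q / δ))) = 1 := by
    rw [mul_div_cancel₀ _ hδ.ne', Real.exp_neg, Real.exp_log hq, mul_inv_cancel₀ hq.ne']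
  rw [integral_const_mul, ht1] at h
  have hV1 : V.eval 1 = 0 := by simp [hV]
  rw [hV1, mul_zero, sub_zero] at h
  refine (mul_eq_zero.mp h).resolve_left ?_
  rw [sq_sub_sq]
  exact mul_ne_zero (by simpa using hδ.ne') (mul_ne_zero hs.ne' (sub_ne_zero.mpr hne))

end Integrals

/-! ### The Hulthén eigenfunctions -/

section Hulthen

open MeasureTheory Set Filter Topology

variable {μ δ q : ℝ}

lemma hulthenPoly_eq (μ δ q : ℝ) (n : ℕ) (x : ℝ) :
    hulthenPoly μ δ q n x
      = (hypPoly (hulthenParam μ δ q n) n).eval (q * Real.exp (-(δ * x))) :=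
  ordinaryHypergeometric_eq_hypPoly _ _ _

/-- The decay exponent of the `n`-th eigenfunction, in units of `δ`. -/
def hulthenExponent (μ δ q : ℝ) (n : ℕ) : ℝ := (hulthenParam μ δ q n - n - 1) / 2

lemma hulthenOverlapIntegrand_eq (hδ : 0 < δ) (hq : 0 < q) (n m : ℕ) (x : ℝ) :
    hulthenOverlapIntegrand μ δ q n m x
      = Real.exp (-((hulthenExponent μ δ q n + hulthenExponent μ δ q m) * δ * x))
        * ((1 - Polynomial.X) ^ 2 * hypPoly (hulthenParam μ δ q n) n
            * hypPoly (hulthenParam μ δ q m) m).eval (q * Real.exp (-(δ * x))) := by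
  rw [hulthenOverlapIntegrand, hulthenPoly_eq, hulthenPoly_eq]
  simp only [Polynomial.eval_mul, Polynomial.eval_pow, Polynomial.eval_sub, Polynomial.eval_one,
    Polynomial.eval_X, ← mul_assoc]
  congr 5
  have : (n : ℝ) + 1 ≠ 0 := by positivity
  have : (1 : ℝ) + n ≠ 0 := by positivity
  have : (m : ℝ) + 1 ≠ 0 := by positivity
  have : (1 : ℝ) + m ≠ 0 := by positivity
  rw [hulthenExponent, hulthenExponent, hulthenParam, hulthenParam]
  field_simp
  ring

lemma hulthenExponent_add_pos (hδ : 0 < δ) (hq : 0 < q) {n m : ℕ}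
    (h : q * δ ^ 2 * (m + 1) * (n + 1) < 2 * μ) :
    0 < hulthenExponent μ δ q n + hulthenExponent μ δ q m := by
  have e : hulthenExponent μ δ q n + hulthenExponent μ δ q m
      = (2 + m + n) * (2 * μ - q * δ ^ 2 * (m + 1) * (n + 1))
        / (2 * q * δ ^ 2 * (m + 1) * (n + 1)) := by
    rw [hulthenExponent, hulthenExponent, hulthenParam, hulthenParam]
    field_simp
    ring
  rw [e]
  have : 0 < 2 * μ - q * δ ^ 2 * (m + 1) * (n + 1) := by linarith
  positivity

lemma hulthenExponent_strictAnti (hμ : 0 < μ) (hδ : 0 < δ) (hq : 0 < q) :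
    StrictAnti (hulthenExponent μ δ q) := by
  intro n m h
  have h' : (n : ℝ) < m := by exact_mod_cast h
  have : hulthenParam μ δ q m < hulthenParam μ δ q n := by
    unfold hulthenParam
    gcongr
  unfold hulthenExponent
  linarith

lemma integrableOn_hulthenOverlapIntegrand (hδ : 0 < δ) (hq : 0 < q) {n m : ℕ}
    (h : q * δ ^ 2 * (m + 1) * (n + 1) < 2 * μ) :
    IntegrableOn (hulthenOverlapIntegrand μ δ q n m) (Ioi (Real.log q / δ)) := by
  rw [funext (hulthenOverlapIntegrand_eq hδ hq n m)]
  exact integrableOn_exp_mul_eval hδ (hulthenExponent_add_pos hδ hq h) _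

-- Puts the equation of every f_n in a form whose constant 2μ/(qδ²) is independent of n, as the
-- Wronskian argument requires.
open Polynomial in
lemma hulthen_ode (hδ : 0 < δ) (hq : 0 < q) {n : ℕ} (h : HulthenPolyDefined μ δ q n) (t : ℝ) :
    (1 - t) * (t * (derivative (derivative (hypPoly (hulthenParam μ δ q n) n))).eval t
        + (2 * hulthenExponent μ δ q n + 1) * (derivative (hypPoly (hulthenParam μ δ q n) n)).eval t)
      - 2 * t * (derivative (hypPoly (hulthenParam μ δ q n) n)).eval t
      + (2 * μ / (q * δ ^ 2) - 2 * hulthenExponent μ δ q n - 1)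
        * (hypPoly (hulthenParam μ δ q n) n).eval t = 0 := by
  have e : 2 * μ / (q * δ ^ 2) = (n + 1) * hulthenParam μ δ q n := by
    rw [hulthenParam]; field_simp
  rw [e, ← hypPoly_ode h t, hulthenExponent]
  ring

lemma hulthenOverlap_eq_zero (hμ : 0 < μ) (hδ : 0 < δ) (hq : 0 < q) {n m : ℕ} (hnm : m ≠ n)
    (h : q * δ ^ 2 * (m + 1) * (n + 1) < 2 * μ)
    (hn : HulthenPolyDefined μ δ q n) (hm : HulthenPolyDefined μ δ q m) :
    hulthenOverlap μ δ q n m = 0 := by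
  rw [hulthenOverlap, funext (hulthenOverlapIntegrand_eq hδ hq n m)]
  exact integral_eq_zero_of_ode hδ hq (hulthenExponent_add_pos hδ hq h)
    ((hulthenExponent_strictAnti hμ hδ hq).injective.ne hnm.symm)
    (hulthen_ode hδ hq hn) (hulthen_ode hδ hq hm)

lemma add_one_lt_hulthenParam (hδ : 0 < δ) (hq : 0 < q) {n : ℕ}
    (h : q * δ ^ 2 * (n + 1) ^ 2 < 2 * μ) : (n : ℝ) + 1 < hulthenParam μ δ q n := by
  rw [hulthenParam, lt_div_iff₀ (by positivity)]
  linarith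

lemma hulthenPolyDefined_of_lt (hδ : 0 < δ) (hq : 0 < q) {n : ℕ}
    (h : q * δ ^ 2 * (n + 1) ^ 2 < 2 * μ) : HulthenPolyDefined μ δ q n := by
  intro i _
  have := add_one_lt_hulthenParam hδ hq h
  have : (0 : ℝ) ≤ i := by positivity
  linarith

lemma hulthenClosedForm_eq (hδ : 0 < δ) (hq : 0 < q) {n : ℕ}
    (h : q * δ ^ 2 * (n + 1) ^ 2 < 2 * μ) :
    hulthenClosedForm μ δ q n = q ^ (-(hulthenParam μ δ q n - n - 1)) / δ
      * hypNormSq (hulthenParam μ δ q n) n := by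
  have ha := add_one_lt_hulthenParam hδ hq h
  -- Eliminating μ in favour of a reduces the rational prefactor of T_n to (a-n-1)/((a-1)(a+2)).
  have hμ' : μ = hulthenParam μ δ q n * (q * δ ^ 2 * (n + 1)) / 2 := by
    rw [hulthenParam]; field_simp
  have hT (hn : n ≠ 0) : -(hypCoeff (hulthenParam μ δ q n) n n
        * hypMoment (hulthenParam μ δ q n) n (hulthenParam μ δ q n))
      = 2 / ((hulthenParam μ δ q n - n - 1) * (hulthenParam μ δ q n - n)
          * (hulthenParam μ δ q n - n + 1))
        * (q * δ ^ 2 * (n + 1) * (2 * μ - q * δ ^ 2 * (n + 1) ^ 2)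
            * poch (hulthenParam μ δ q n + 1) n
          / (2 * (2 * μ - q * δ ^ 2 * (n + 1)) * (q * δ ^ 2 * (n + 1) + μ)
            * poch (-hulthenParam μ δ q n - 1) n)
          * threeFTwo (1 - n) (hulthenParam μ δ q n + 1) (hulthenParam μ δ q n)
              (hulthenParam μ δ q n + 3) (hulthenParam μ δ q n - n) 1) := by
    obtain ⟨m, rfl⟩ := Nat.exists_eq_succ_of_ne_zero hn
    rw [Nat.succ_eq_add_one] at *
    rw [leading_term_eq (by push_cast at ha; linarith)]
    congr 2
    generalize hulthenParam μ δ q (m + 1) = a at *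
    subst hμ'
    push_cast at ha ⊢
    have hm : (0 : ℝ) ≤ m := by positivity
    have h1 : a - 1 ≠ 0 := by linarith
    have h2 : a + 2 ≠ 0 := by linarith
    have e1 : 2 * (a * (q * δ ^ 2 * (m + 1 + 1)) / 2) - q * δ ^ 2 * (m + 1 + 1)
        = (a - 1) * (q * δ ^ 2 * (m + 1 + 1)) := by ring
    have e2 : q * δ ^ 2 * (m + 1 + 1) + a * (q * δ ^ 2 * (m + 1 + 1)) / 2
        = (a + 2) * (q * δ ^ 2 * (m + 1 + 1)) / 2 := by ring
    have e3 : 2 * (a * (q * δ ^ 2 * (m + 1 + 1)) / 2) - q * δ ^ 2 * (m + 1 + 1) ^ 2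
        = (a - (m + 1) - 1) * (q * δ ^ 2 * (m + 1 + 1)) := by ring
    rw [e1, e2, e3]
    have h3 : q * δ ^ 2 * ((m : ℝ) + 1 + 1) ≠ 0 := by positivity
    generalize q * δ ^ 2 * ((m : ℝ) + 1 + 1) = c at *
    field_simp
  have hΓ : Real.Gamma (hulthenParam μ δ q n - n + 2)
      = (hulthenParam μ δ q n - n + 1) * (hulthenParam μ δ q n - n)
        * (hulthenParam μ δ q n - n - 1) * Real.Gamma (hulthenParam μ δ q n - n - 1) := by
    have h0 : hulthenParam μ δ q n - n - 1 ≠ 0 := by linarith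
    have h1 : hulthenParam μ δ q n - n ≠ 0 := by linarith
    have h2 : hulthenParam μ δ q n - n + 1 ≠ 0 := by linarith
    have g0 := Real.Gamma_add_one h0
    rw [sub_add_cancel] at g0
    rw [show hulthenParam μ δ q n - n + 2 = hulthenParam μ δ q n - n + 1 + 1 by ring,
      Real.Gamma_add_one h2, Real.Gamma_add_one h1, g0]
    ring
  have hΓ0 := (Real.Gamma_pos_of_pos (by linarith : 0 < hulthenParam μ δ q n - n - 1)).ne'
  have hp : 2 * q ^ ((n : ℝ) + 1 - hulthenParam μ δ q n)
        * Real.Gamma (hulthenParam μ δ q n - n - 1)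
        / (δ * Real.Gamma (hulthenParam μ δ q n - n + 2))
      = q ^ (-(hulthenParam μ δ q n - n - 1)) / δ
        * (2 / ((hulthenParam μ δ q n - n - 1) * (hulthenParam μ δ q n - n)
          * (hulthenParam μ δ q n - n + 1))) := by
    have h0 : hulthenParam μ δ q n - n - 1 ≠ 0 := by linarith
    have h1 : hulthenParam μ δ q n - n ≠ 0 := by linarith
    have h2 : hulthenParam μ δ q n - n + 1 ≠ 0 := by linarith
    rw [hΓ, show (n : ℝ) + 1 - hulthenParam μ δ q n = -(hulthenParam μ δ q n - n - 1) by ring]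
    generalize hulthenParam μ δ q n - n - 1 = u at *
    field_simp
  rw [hypNormSq_eq ha]
  simp only [hulthenClosedForm]
  rw [show 2 * μ / (q * δ ^ 2 * ((n : ℝ) + 1)) = hulthenParam μ δ q n from rfl, hp, mul_assoc, mul_add]
  congr 2
  split_ifs with hn
  · simp
  · rw [hT hn]

lemma hulthenOverlapIntegrand_self_nonneg (μ δ q : ℝ) (n : ℕ) (x : ℝ) :
    0 ≤ hulthenOverlapIntegrand μ δ q n n x := by
  rw [hulthenOverlapIntegrand, mul_assoc _ (hulthenPoly μ δ q n x)]
  have := mul_self_nonneg (hulthenPoly μ δ q n x)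
  positivity

lemma hulthenOverlap_self_pos (hδ : 0 < δ) (hq : 0 < q) {n : ℕ}
    (h : q * δ ^ 2 * (n + 1) ^ 2 < 2 * μ) : 0 < hulthenOverlap μ δ q n n := by
  have hi : IntegrableOn (hulthenOverlapIntegrand μ δ q n n) (Ioi (Real.log q / δ)) :=
    integrableOn_hulthenOverlapIntegrand hδ hq (by linarith)
  rw [hulthenOverlap, setIntegral_pos_iff_support_of_nonneg_ae
    (Eventually.of_forall (hulthenOverlapIntegrand_self_nonneg μ δ q n)) hi]
  -- As x → ∞, t → 0 and f_n → f_n(0) = 1, so the nonnegative integrand is nonzero on a whole ray.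
  have hlim : Tendsto (fun x => ((1 - Polynomial.X) ^ 2 * hypPoly (hulthenParam μ δ q n) n
      * hypPoly (hulthenParam μ δ q n) n).eval (q * Real.exp (-(δ * x)))) atTop (𝓝 1) := by
    have h1 : Tendsto (fun x : ℝ => q * Real.exp (-(δ * x))) atTop (𝓝 (q * 0)) :=
      (Real.tendsto_exp_neg_atTop_nhds_zero.comp (tendsto_id.const_mul_atTop hδ)).const_mul q
    have h2 := ((1 - Polynomial.X) ^ 2 * hypPoly (hulthenParam μ δ q n) n
      * hypPoly (hulthenParam μ δ q n) n).continuous.tendsto (q * 0)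
    have h3 : (hypPoly (hulthenParam μ δ q n) n).eval 0 = 1 := by
      rw [← Polynomial.coeff_zero_eq_eval_zero, hypPoly_coeff, hypCoeff_zero]
    have h4 := h2.comp h1
    simpa [h3, Function.comp_def] using h4
  obtain ⟨M, hM⟩ := ((hlim.eventually_ne one_ne_zero).and
    (eventually_gt_atTop (Real.log q / δ))).exists_forall_of_atTop
  refine lt_of_lt_of_le (b := volume (Ioi M)) (by simp) (measure_mono fun x hx => ?_)
  have := hM x (le_of_lt hx)
  refine ⟨?_, this.2⟩
  rw [Function.mem_support, hulthenOverlapIntegrand_eq hδ hq]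
  exact mul_ne_zero (Real.exp_pos _).ne' this.1

lemma hulthenOverlap_self (hδ : 0 < δ) (hq : 0 < q) {n : ℕ}
    (h : q * δ ^ 2 * (n + 1) ^ 2 < 2 * μ) :
    hulthenOverlap μ δ q n n = hulthenClosedForm μ δ q n := by
  rw [hulthenClosedForm_eq hδ hq h, ← integral_hypPoly_sq hδ hq (add_one_lt_hulthenParam hδ hq h),
    hulthenOverlap]
  congr 1
  ext x
  rw [hulthenOverlapIntegrand_eq hδ hq]
  simp only [Polynomial.eval_mul, Polynomial.eval_pow, Polynomial.eval_sub, Polynomial.eval_one,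
    Polynomial.eval_X, hulthenExponent, add_halves]
  ring

lemma hulthenClosedForm_pos (hδ : 0 < δ) (hq : 0 < q) {n : ℕ}
    (h : q * δ ^ 2 * (n + 1) ^ 2 < 2 * μ) : 0 < hulthenClosedForm μ δ q n := by
  rw [← hulthenOverlap_self hδ hq h]
  exact hulthenOverlap_self_pos hδ hq h

lemma hulthenPsi_mul_hulthenPsi (hδ : 0 < δ) (hq : 0 < q) (N N' : ℝ) (n m : ℕ) (x : ℝ) :
    hulthenPsi μ δ q N n x * hulthenPsi μ δ q N' m x
      = N * N' * hulthenOverlapIntegrand μ δ q n m x := by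
  rw [hulthenOverlapIntegrand, hulthenPsi, hulthenPsi,
    show -((2 + m + n) * (2 * μ - q * δ ^ 2 * (1 + m) * (1 + n)) * x
        / (2 * δ * (1 + m) * (1 + n) * q))
      = -((μ / (q * δ * (n + 1)) - (n + 1) * δ / 2) * x)
        + -((μ / (q * δ * (m + 1)) - (m + 1) * δ / 2) * x) by
      have : (n : ℝ) + 1 ≠ 0 := by positivity
      have : (1 : ℝ) + n ≠ 0 := by positivity
      have : (m : ℝ) + 1 ≠ 0 := by positivity
      have : (1 : ℝ) + m ≠ 0 := by positivity
      field_simp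
      ring, Real.exp_add]
  ring

lemma rpow_neg_half_sq {x : ℝ} (hx : 0 < x) : (x ^ (-(1 / 2) : ℝ)) ^ 2 * x = 1 := by
  rw [← Real.rpow_natCast, ← Real.rpow_mul hx.le]
  norm_num
  rw [Real.rpow_neg_one, inv_mul_cancel₀ hx.ne']

lemma integrableOn_hulthenPsi_mul (hδ : 0 < δ) (hq : 0 < q) (N N' : ℝ) {n m : ℕ}
    (h : q * δ ^ 2 * (m + 1) * (n + 1) < 2 * μ) :
    IntegrableOn (fun x => hulthenPsi μ δ q N n x * hulthenPsi μ δ q N' m x)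
      (Ioi (Real.log q / δ)) := by
  simp only [hulthenPsi_mul_hulthenPsi hδ hq]
  exact (integrableOn_hulthenOverlapIntegrand hδ hq h).const_mul _

/-- By the inequality 2(m+1)(n+1) ≤ (m+1)^2 + (n+1)^2. -/
lemma mul_succ_lt_of_sq_lt (hq : 0 < q) {n m : ℕ}
    (hn : q * δ ^ 2 * (n + 1) ^ 2 < 2 * μ) (hm : q * δ ^ 2 * (m + 1) ^ 2 < 2 * μ) :
    q * δ ^ 2 * (m + 1) * (n + 1) < 2 * μ := by
  have : 0 ≤ q * δ ^ 2 * ((n : ℝ) - m) ^ 2 := by positivity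
  linarith

lemma hulthenBraces_eq (v q : ℝ) (n : ℕ) :
    hulthenBraces v q n = hulthenClosedForm (v / 2) 1 q n := by
  have e : 2 * (v / 2) = v := by ring
  simp only [hulthenBraces, hulthenClosedForm, one_pow, mul_one, one_mul, e]
  rw [show 2 * (v - q * ((n : ℝ) + 1)) * (q * (n + 1) + v / 2)
    = (v - q * (n + 1)) * (2 * q * (n + 1) + v) by ring]

lemma hulthenUnitSq_eq (hq : 0 < q) (v : ℝ) (n : ℕ) (r : ℝ) :
    hulthenUnitSq v q n r = hulthenOverlapIntegrand (v / 2) 1 q n n r := by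
  have h1 : (n : ℝ) + 1 ≠ 0 := by positivity
  have h2 : (1 : ℝ) + n ≠ 0 := by positivity
  have e : hulthenParam (v / 2) 1 q n = v / ((n + 1) * q) := by
    rw [hulthenParam]; field_simp
  rw [hulthenUnitSq, hulthenOverlapIntegrand, hulthenPoly, e,
    show -((2 + n + n) * (2 * (v / 2) - q * 1 ^ 2 * (1 + n) * (1 + n)) * r
      / (2 * 1 * (1 + n) * (1 + n) * q)) = -((v / (q * (n + 1)) - n - 1) * r) by
      field_simp; ring]
  simp only [one_mul]
  ring

end Hulthen

end

theorem mainTheorem1 (μ δ q : ℝ) (hμ : 0 < μ) (hδ : 0 < δ) (hq : 0 < q) :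
    -- the overlap integrals vanish off the diagonal
    (∀ n m : ℕ, m ≠ n → q * δ ^ 2 * (m + 1) * (n + 1) < 2 * μ →
      HulthenPolyDefined μ δ q n → HulthenPolyDefined μ δ q m →
      MeasureTheory.IntegrableOn (hulthenOverlapIntegrand μ δ q n m)
          (Set.Ioi (Real.log q / δ)) ∧
        hulthenOverlap μ δ q n m = 0) ∧
    -- the closed form on the diagonal
    (∀ n : ℕ, q * δ ^ 2 * (n + 1) ^ 2 < 2 * μ →
      HulthenPolyDefined μ δ q n ∧
      MeasureTheory.IntegrableOn (hulthenOverlapIntegrand μ δ q n n)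
          (Set.Ioi (Real.log q / δ)) ∧
        hulthenOverlap μ δ q n n = hulthenClosedForm μ δ q n ∧
        0 < hulthenClosedForm μ δ q n) ∧
    -- orthonormality of the eigenfunctions with the constants `I_{nn}^{-1/2}`
    (∀ n m : ℕ, q * δ ^ 2 * (n + 1) ^ 2 < 2 * μ → q * δ ^ 2 * (m + 1) ^ 2 < 2 * μ →
      MeasureTheory.IntegrableOn
          (fun x => hulthenPsi μ δ q (hulthenClosedForm μ δ q n ^ (-(1 / 2) : ℝ)) n x
            * hulthenPsi μ δ q (hulthenClosedForm μ δ q m ^ (-(1 / 2) : ℝ)) m x)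
          (Set.Ioi (Real.log q / δ)) ∧
        ∫ x in Set.Ioi (Real.log q / δ),
          hulthenPsi μ δ q (hulthenClosedForm μ δ q n ^ (-(1 / 2) : ℝ)) n x
            * hulthenPsi μ δ q (hulthenClosedForm μ δ q m ^ (-(1 / 2) : ℝ)) m x
          = if n = m then 1 else 0) ∧
    -- the normalization constant for `δ = 1`, `v = 2μ`
    (∀ v : ℝ, 0 < v → ∀ n : ℕ, q * (n + 1) ^ 2 < v →
      0 < hulthenBraces v q n ∧
      MeasureTheory.IntegrableOn (hulthenUnitSq v q n) (Set.Ioi (Real.log q)) ∧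
      hulthenNormConst v q n ^ 2 * ∫ r in Set.Ioi (Real.log q), hulthenUnitSq v q n r = 1) := by
  refine ⟨fun n m hnm h hn hm => ⟨integrableOn_hulthenOverlapIntegrand hδ hq h,
    hulthenOverlap_eq_zero hμ hδ hq hnm h hn hm⟩, fun n h => ⟨hulthenPolyDefined_of_lt hδ hq h,
    integrableOn_hulthenOverlapIntegrand hδ hq (by linarith), hulthenOverlap_self hδ hq h,
    hulthenClosedForm_pos hδ hq h⟩, fun n m hn hm => ?_, fun v hv n h => ?_⟩
  · have hnm := mul_succ_lt_of_sq_lt hq hn hm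
    refine ⟨integrableOn_hulthenPsi_mul hδ hq _ _ hnm, ?_⟩
    simp only [hulthenPsi_mul_hulthenPsi hδ hq]
    rw [MeasureTheory.integral_const_mul, ← hulthenOverlap]
    split_ifs with h
    · subst h
      rw [hulthenOverlap_self hδ hq hn, ← sq, rpow_neg_half_sq (hulthenClosedForm_pos hδ hq hn)]
    · rw [hulthenOverlap_eq_zero hμ hδ hq (Ne.symm h) hnm (hulthenPolyDefined_of_lt hδ hq hn)
        (hulthenPolyDefined_of_lt hδ hq hm), mul_zero]
  -- The diagonal results are applied with δ = 1 and μ = v/2, unrelated to the ambient μ and δ.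
  · have h' : q * 1 ^ 2 * ((n : ℝ) + 1) ^ 2 < 2 * (v / 2) := by linarith
    have hpos := hulthenClosedForm_pos one_pos hq h'
    have hi := integrableOn_hulthenOverlapIntegrand one_pos hq (mul_succ_lt_of_sq_lt hq h' h')
    have hI := hulthenOverlap_self one_pos hq h'
    rw [div_one] at hi
    rw [hulthenOverlap, div_one] at hI
    rw [hulthenNormConst, hulthenBraces_eq, funext (hulthenUnitSq_eq hq v n), hI]
    exact ⟨hpos, hi, rpow_neg_half_sq hpos⟩
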